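/- All graphs are finite and simple. Let $m\ge 1$ be an integer and let $G$ be a graph of order $n$ with (vertex) connectivity $\kappa(G)\ge 2m+1$, where $\kappa(G)$ is the least number of vertices whose deletion leaves a graph that is disconnected or has at most one vertex. Let $$\sigma_3(G)=\min\Big\{\sum_{x\in X}d_G(x) : X\subseteq V(G)\text{ independent},\ |X|=3\Big\},$$ with $\sigma_3(G)=+\infty$ if $G$ has no three pairwise non-adjacent vertices. If $\sigma_3(G)\ge n+2m$, then $G$ is a $(P_{\ge 3},m)$-factor deleted graph; that is, for every set $E'\subseteq E(G)$ with $|E'|=m$, the graph $G-E'$ has a $P_{\ge 3}$-factor, i.e. a spanning subgraph each of whose connected components is isomorphic to a path with at least three vertices. -/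

import Mathlib

namespace SimpleGraph

/-- The (vertex) connectivity `κ(G)` of a finite graph: the least number of vertices whose deletion
leaves a graph that is disconnected or has at most one vertex. In particular the complete graph on
`n ≥ 1` vertices has connectivity `n - 1`. -/
noncomputable def vertexConnectivity {V : Type*} [Fintype V] (G : SimpleGraph V) : ℕ :=
  sInf {c : ℕ | ∃ S : Finset V, S.card = c ∧
    (¬ (G.induce ((S : Set V)ᶜ)).Preconnected ∨ Fintype.card V ≤ S.card + 1)}

/-- The degree sum `σ_k(G)`: the minimum, over all independent sets `X` of exactly `k` vertices, of
the sum of the degrees of the vertices of `X`; it is `+∞` if there is no such set. -/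
noncomputable def degreeSum {V : Type*} [Fintype V] (G : SimpleGraph V) [DecidableRel G.Adj]
    (k : ℕ) : ℕ∞ :=
  ⨅ (X : Finset V) (_ : G.IsNIndepSet k X), ((∑ x ∈ X, G.degree x : ℕ) : ℕ∞)

/-- `H` is a `P_{≥ k}`-factor of `G`: a spanning subgraph each of whose components is isomorphic to
a path of order at least `k`. -/
def IsPathFactor {V : Type*} (G H : SimpleGraph V) (k : ℕ) : Prop :=
  H ≤ G ∧ ∀ C : H.ConnectedComponent,
    ∃ r : ℕ, k ≤ r ∧ Nonempty (C.toSimpleGraph ≃g pathGraph r)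

/-- `G` is a `(P_{≥ k}, m)`-factor deleted graph: `G - E'` has a `P_{≥ k}`-factor for every set `E'`
of exactly `m` edges of `G`. -/
def IsPathFactorDeleted {V : Type*} (G : SimpleGraph V) (k m : ℕ) : Prop :=
  ∀ E' : Finset (Sym2 V), (E' : Set (Sym2 V)) ⊆ G.edgeSet → E'.card = m →
    ∃ H : SimpleGraph V, IsPathFactor (G.deleteEdges (E' : Set (Sym2 V))) H k

end SimpleGraph

/-! Write `H` for `G - E'` and `n` for the order. Cover the vertices of `H` by disjoint paths with
as few short paths (at most two vertices) as possible. If `H` has no `P_{≥ 3}`-factor, a short path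
`B` remains, and minimality forbids every rerouting that removes a short path.

Let `z ∈ B` have a neighbour `v` outside `B`. Then `v` is an inner vertex of its path, and splits it
into two legs of one or two vertices (`length_legs`). Joining `B` to `v` and one leg cuts off the
other leg, which becomes the short path of another minimal cover (`expose`). Legs thus inherit the
properties of short paths, notably that each contains a vertex of degree at most `(n + 1) / 3`: a
vertex forming a path alone has at most one neighbour on each long path and none on a short one.
Further reroutings make the chosen vertices non-adjacent. With one vertex of `B`, this gives `2k +
1` independent vertices of small degree when `z` has `k` neighbours outside `B`.

Since `κ(G) ≥ 2m + 1` bounds the minimum degree, some `z ∈ B` has `k ≥ m + 1`. The deleted edges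
meet at most `2m` of the `2m + 3` vertices; three others are independent in `G` with unchanged
degrees, of sum at most `n + 1 < n + 2m`. -/

namespace SimpleGraph

/-! ### Minimal path covers and exchange of paths -/

section PathCover

variable {V : Type*} {H : SimpleGraph V}

/-- A partition of the vertex set into the vertex sets of paths of `H`, each path being given as
the list of its vertices. -/
structure IsPathCover (H : SimpleGraph V) (L : List (List V)) : Prop where
  isChain : ∀ P ∈ L, P.IsChain H.Adj
  ne_nil : ∀ P ∈ L, P ≠ []
  nodup : L.flatten.Nodup
  mem : ∀ v, v ∈ L.flatten

/-- The number of paths with at most two vertices. -/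
def shortCount (L : List (List V)) : ℕ := L.countP (fun P => P.length < 3)

/-- The number of paths with at least three vertices. -/
def longCount (L : List (List V)) : ℕ := L.countP (fun P => 3 ≤ P.length)

/-- A path cover with the least number of paths with at most two vertices. -/
structure IsMinPathCover (H : SimpleGraph V) (L : List (List V)) : Prop
    extends IsPathCover H L where
  le : ∀ L', IsPathCover H L' → shortCount L ≤ shortCount L'

theorem IsPathCover.perm {L L' : List (List V)} (h : IsPathCover H L) (hp : L.Perm L') :
    IsPathCover H L' where
  isChain P hP := h.isChain P (hp.mem_iff.2 hP)
  ne_nil P hP := h.ne_nil P (hp.mem_iff.2 hP)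
  nodup := hp.flatten.nodup_iff.1 h.nodup
  mem v := hp.flatten.mem_iff.1 (h.mem v)

theorem IsPathCover.length_flatten_eq [Fintype V] {L : List (List V)} (h : IsPathCover H L) :
    L.flatten.length = Fintype.card V := by
  classical
  rw [← List.toFinset_card_of_nodup h.nodup, ← Finset.card_univ]
  congr 1
  ext v
  simpa using h.mem v

theorem IsMinPathCover.perm {L L' : List (List V)} (h : IsMinPathCover H L) (hp : L.Perm L') :
    IsMinPathCover H L' where
  toIsPathCover := h.toIsPathCover.perm hp
  le L'' h'' := by
    have := h.le L'' h''
    unfold shortCount at *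
    rwa [← hp.countP_eq]

theorem IsPathCover.exchange {X Y R : List (List V)} (h : IsPathCover H (X ++ R))
    (hY : ∀ P ∈ Y, P.IsChain H.Adj ∧ P ≠ []) (hp : Y.flatten.Perm X.flatten) :
    IsPathCover H (Y ++ R) where
  isChain P hP := by
    rcases List.mem_append.1 hP with hP | hP
    · exact (hY P hP).1
    · exact h.isChain P (List.mem_append_right _ hP)
  ne_nil P hP := by
    rcases List.mem_append.1 hP with hP | hP
    · exact (hY P hP).2
    · exact h.ne_nil P (List.mem_append_right _ hP)
  nodup := by
    have := h.nodup
    rw [List.flatten_append] at this ⊢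
    exact (hp.append_right _).nodup_iff.2 this
  mem v := by
    have := h.mem v
    rw [List.flatten_append] at this ⊢
    exact (hp.append_right _).mem_iff.2 this

theorem shortCount_append (X Y : List (List V)) :
    shortCount (X ++ Y) = shortCount X + shortCount Y := by
  simp [shortCount]

/-- Source of the contradictions by rerouting: only the few affected paths need to be compared. -/
theorem IsMinPathCover.not_lt {X Y R : List (List V)} (h : IsMinPathCover H (X ++ R))
    (hY : ∀ P ∈ Y, P.IsChain H.Adj ∧ P ≠ []) (hp : Y.flatten.Perm X.flatten) :
    ¬ shortCount Y < shortCount X := by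
  have := h.le _ (h.toIsPathCover.exchange hY hp)
  rw [shortCount_append, shortCount_append] at this
  omega

theorem IsMinPathCover.exchange {X Y R : List (List V)} (h : IsMinPathCover H (X ++ R))
    (hY : ∀ P ∈ Y, P.IsChain H.Adj ∧ P ≠ []) (hp : Y.flatten.Perm X.flatten)
    (hc : shortCount Y ≤ shortCount X) : IsMinPathCover H (Y ++ R) where
  toIsPathCover := h.toIsPathCover.exchange hY hp
  le L' hL' := by
    have := h.le L' hL'
    rw [shortCount_append] at this ⊢
    omega

theorem isChain_adj_reverse {P : List V} (h : P.IsChain H.Adj) : P.reverse.IsChain H.Adj := by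
  rw [List.isChain_reverse]
  exact h.imp fun _ _ h => h.symm

theorem isChain_join {Q Q' : List V} {u v : V} (h : (Q ++ [u]).IsChain H.Adj)
    (h' : (v :: Q').IsChain H.Adj) (huv : H.Adj u v) : (Q ++ u :: v :: Q').IsChain H.Adj := by
  rw [List.isChain_append_cons_cons]
  exact ⟨h, huv, h'⟩

/-- With at most two vertices, each one is an end, so a short path or leg can be attached by any of
its vertices. -/
theorem exists_perm_isChain_concat {P : List V} (h : P.IsChain H.Adj) (hP : P.length ≤ 2) {u : V}
    (hu : u ∈ P) : ∃ Q, (Q ++ [u]).IsChain H.Adj ∧ (Q ++ [u]).Perm P := by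
  match P, h, hP, hu with
  | [a], h, _, hu =>
    obtain rfl : u = a := by simpa using hu
    exact ⟨[], by simp, by simp⟩
  | [a, b], h, _, hu =>
    rcases (by simpa using hu : u = a ∨ u = b) with rfl | rfl
    · exact ⟨[b], by simpa using (by simpa using h : H.Adj u b).symm, List.Perm.swap _ _ _⟩
    · exact ⟨[a], h, List.Perm.refl _⟩

theorem IsMinPathCover.exists_perm_cons {L : List (List V)} (h : IsMinPathCover H L) {P : List V}
    (hP : P ∈ L) : ∃ R, IsMinPathCover H (P :: R) ∧ L.Perm (P :: R) := by
  obtain ⟨s, t, rfl⟩ := List.append_of_mem hP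
  exact ⟨s ++ t, h.perm List.perm_middle, List.perm_middle⟩

theorem IsMinPathCover.exists_perm_cons_cons {B P : List V} {R : List (List V)}
    (h : IsMinPathCover H (B :: R)) (hP : P ∈ R) :
    ∃ R', IsMinPathCover H (B :: P :: R') ∧ R.Perm (P :: R') := by
  obtain ⟨s, t, rfl⟩ := List.append_of_mem hP
  exact ⟨s ++ t, h.perm (List.perm_middle.cons _), List.perm_middle⟩

theorem IsMinPathCover.reverse_head {P : List V} {R : List (List V)}
    (h : IsMinPathCover H (P :: R)) : IsMinPathCover H (P.reverse :: R) := by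
  refine h.exchange (X := [P]) (Y := [P.reverse]) ?_ ?_ ?_
  · simpa using ⟨isChain_adj_reverse (h.isChain P (by simp)), h.ne_nil P (by simp)⟩
  · simp
  · simp [shortCount]

theorem IsMinPathCover.reverse_second {B P : List V} {R : List (List V)}
    (h : IsMinPathCover H (B :: P :: R)) : IsMinPathCover H (B :: P.reverse :: R) :=
  ((h.perm (List.Perm.swap _ _ _)).reverse_head).perm (List.Perm.swap _ _ _)

theorem IsMinPathCover.reverse_centered {B A C : List V} {v : V} {R : List (List V)}
    (h : IsMinPathCover H (B :: (A ++ v :: C) :: R)) :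
    IsMinPathCover H (B :: (C.reverse ++ v :: A.reverse) :: R) := by
  simpa using h.reverse_second

theorem IsMinPathCover.perm_head {B B' : List V} {R : List (List V)}
    (h : IsMinPathCover H (B :: R)) (hB' : B'.IsChain H.Adj) (hp : B'.Perm B) :
    IsMinPathCover H (B' :: R) := by
  refine h.exchange (X := [B]) (Y := [B']) ?_ ?_ ?_
  · have := h.ne_nil B (by simp)
    simp only [List.mem_singleton, forall_eq]
    refine ⟨hB', fun h0 => this ?_⟩
    subst h0
    exact List.nil_perm.1 hp
  · simpa using hp
  · simp [shortCount, hp.length_eq]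

/-- A path that contains a neighbour `v` of a vertex of a short path has one or two vertices on
each side of `v`. -/
theorem IsMinPathCover.length_legs {B A C : List V} {z v : V} {R : List (List V)}
    (h : IsMinPathCover H (B :: (A ++ v :: C) :: R)) (hB : B.length ≤ 2) (hz : z ∈ B)
    (hzv : H.Adj z v) : (1 ≤ A.length ∧ A.length ≤ 2) ∧ 1 ≤ C.length ∧ C.length ≤ 2 := by
  obtain ⟨Z, hZ, hp⟩ := exists_perm_isChain_concat (h.isChain B (by simp)) hB hz
  have hP := h.isChain (A ++ v :: C) (by simp)
  have key : ∀ A C : List V, IsMinPathCover H ((Z ++ [z]) :: (A ++ v :: C) :: R) →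
      1 ≤ A.length ∧ A.length ≤ 2 := by
    intro A C h
    have hP := h.isChain (A ++ v :: C) (by simp)
    have hvC := (List.isChain_split.1 hP).2
    have hl : Z.length + 1 ≤ 2 := by
      have := hp.length_eq
      simp at this
      omega
    -- If `A` is empty, `B` extends the path at `v`; if `A` has at least three vertices, it can be
    -- cut off without becoming short.
    by_contra hA
    by_cases hA0 : A = []
    · subst hA0
      refine h.not_lt (X := [_, _]) (Y := [Z ++ z :: v :: C]) ?_ ?_ ?_
      · simpa using isChain_join hZ hvC hzv
      · simp
      · simp [shortCount, List.countP_cons]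
        split_ifs <;> omega
    · have hA1 : 1 ≤ A.length := List.length_pos_iff.2 hA0
      -- The cut requires `C` nonempty, as `z, v` alone could be short; otherwise `v` is an end and
      -- `B` is appended there.
      by_cases hC0 : C = []
      · subst hC0
        refine h.not_lt (X := [_, _]) (Y := [A ++ v :: z :: Z.reverse]) ?_ ?_ ?_
        · simpa using isChain_join (List.isChain_split.1 hP).1
            (by simpa using isChain_adj_reverse hZ) hzv.symm
        · classical
          refine List.perm_iff_count.2 fun a => ?_
          simp [List.count_cons]; ring
        · simp [shortCount, List.countP_cons]
          split_ifs <;> omega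
      · have hC1 : 1 ≤ C.length := List.length_pos_iff.2 hC0
        refine h.not_lt (X := [_, _]) (Y := [A, Z ++ z :: v :: C]) ?_ ?_ ?_
        · have := (List.isChain_append.1 hP).1
          simpa [hA0, this] using isChain_join hZ hvC hzv
        · classical
          refine List.perm_iff_count.2 fun a => ?_
          simp [List.count_cons]; ring
        · simp [shortCount, List.countP_cons]
          split_ifs <;> omega
  have h' := h.perm_head hZ hp
  exact ⟨key A C h', by simpa using key _ _ h'.reverse_centered⟩

/-- The leg `A` takes over the role of the short path. The count does not rise, because the path
through `z`, `v` and `C` has at least three vertices. -/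
theorem IsMinPathCover.expose {Z A C : List V} {z v : V} {R : List (List V)}
    (h : IsMinPathCover H ((Z ++ [z]) :: (A ++ v :: C) :: R)) (hZ : Z.length ≤ 1)
    (hzv : H.Adj z v) : IsMinPathCover H (A :: (Z ++ z :: v :: C) :: R) := by
  obtain ⟨⟨hA, -⟩, hC, -⟩ := h.length_legs (by simpa using hZ) (by simp) hzv
  have hP := h.isChain (A ++ v :: C) (by simp)
  refine h.exchange (X := [_, _]) (Y := [A, Z ++ z :: v :: C]) ?_ ?_ ?_
  · have h1 := (List.isChain_append.1 hP).1
    have h2 : A ≠ [] := List.length_pos_iff.1 hA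
    have h3 := isChain_join (h.isChain (Z ++ [z]) (by simp)) (List.isChain_split.1 hP).2 hzv
    simp [h1, h2, h3]
  · classical
    refine List.perm_iff_count.2 fun a => ?_
    simp [List.count_cons]; ring
  · simp [shortCount, List.countP_cons]
    split_ifs <;> omega

/-- Two legs of different centres adjacent to a path with a single vertex are not adjacent. -/
theorem IsMinPathCover.not_adj_legs_left {A C A' C' : List V} {b v v' u u' : V}
    {R : List (List V)} (h : IsMinPathCover H ([b] :: (A ++ v :: C) :: (A' ++ v' :: C') :: R))
    (hv : H.Adj b v) (hv' : H.Adj b v') (hu : u ∈ A) (hu' : u' ∈ A') : ¬ H.Adj u u' := by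
  intro huu'
  obtain ⟨⟨hA, hA2⟩, hC, hC2⟩ := h.length_legs (by simp) (by simp) hv
  obtain ⟨⟨hA', hA2'⟩, hC', hC2'⟩ := (h.perm ((List.Perm.swap _ _ _).cons _)).length_legs
    (by simp) (by simp) hv'
  have hP := h.isChain (A ++ v :: C) (by simp)
  have hP' := h.isChain (A' ++ v' :: C') (by simp)
  have hvC := (List.isChain_split.1 hP).2
  have hvC' := (List.isChain_split.1 hP').2
  -- Joining the two legs gives a long path unless both are single vertices; in that case the joined
  -- legs keep `v'` and `C'`, and `b` goes with `v` and `C`.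
  by_cases hl : 3 ≤ A.length + A'.length
  · obtain ⟨Q, hQ, hQp⟩ := exists_perm_isChain_concat (List.isChain_append.1 hP).1 hA2 hu
    obtain ⟨Q', hQ', hQp'⟩ := exists_perm_isChain_concat (List.isChain_append.1 hP').1 hA2' hu'
    have e1 := hQp.length_eq
    have e2 := hQp'.length_eq
    refine h.not_lt (X := [_, _, _])
      (Y := [Q ++ u :: u' :: Q'.reverse, C.reverse ++ v :: b :: v' :: C']) ?_ ?_ ?_
    · have h1 := isChain_join hQ (by simpa using isChain_adj_reverse hQ') huu'
      have h2 : (v :: b :: v' :: C').IsChain H.Adj := by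
        simp only [List.isChain_cons_cons]
        exact ⟨hv.symm, hv', hvC'⟩
      have h3 : (C.reverse ++ v :: b :: v' :: C').IsChain H.Adj :=
        List.isChain_split.2 ⟨by simpa using isChain_adj_reverse hvC, h2⟩
      simp [h1, h3]
    · classical
      refine List.perm_iff_count.2 fun a => ?_
      have c1 := hQp.count_eq a
      have c2 := hQp'.count_eq a
      simp [List.count_cons] at c1 c2 ⊢
      rw [← c1, ← c2]
      ring
    · simp at e1 e2
      simp [shortCount, List.countP_cons]
      split_ifs <;> omega
  · obtain ⟨a, rfl⟩ := List.length_eq_one_iff.1 (by omega : A.length = 1)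
    obtain ⟨a', rfl⟩ := List.length_eq_one_iff.1 (by omega : A'.length = 1)
    obtain rfl : u = a := by simpa using hu
    obtain rfl : u' = a' := by simpa using hu'
    refine h.not_lt (X := [_, _, _])
      (Y := [b :: v :: C, u :: u' :: v' :: C']) ?_ ?_ ?_
    · have h1 : H.Adj u' v' := by
        simpa using (List.isChain_split.1 hP').1
      simp [hv, hvC, huu', h1, hvC', -List.isChain_cons_cons, List.isChain_cons_cons]
    · classical
      refine List.perm_iff_count.2 fun a => ?_
      simp [List.count_cons]; ring
    · simp [shortCount, List.countP_cons]

theorem IsMinPathCover.not_adj_legs {A C A' C' : List V} {b v v' u u' : V}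
    {R : List (List V)} (h : IsMinPathCover H ([b] :: (A ++ v :: C) :: (A' ++ v' :: C') :: R))
    (hv : H.Adj b v) (hv' : H.Adj b v') (hu : u ∈ A ∨ u ∈ C) (hu' : u' ∈ A' ∨ u' ∈ C') :
    ¬ H.Adj u u' := by
  have sw : ∀ {P Q : List V}, IsMinPathCover H ([b] :: P :: Q :: R) →
      IsMinPathCover H ([b] :: Q :: P :: R) := fun h => h.perm ((List.Perm.swap _ _ _).cons _)
  rcases hu with hu | hu <;> rcases hu' with hu' | hu'
  · exact h.not_adj_legs_left hv hv' hu hu'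
  · exact (sw (sw h).reverse_centered).not_adj_legs_left hv hv' hu (List.mem_reverse.2 hu')
  · exact h.reverse_centered.not_adj_legs_left hv hv' (List.mem_reverse.2 hu) hu'
  · exact (sw (sw h.reverse_centered).reverse_centered).not_adj_legs_left hv hv'
      (List.mem_reverse.2 hu) (List.mem_reverse.2 hu')

end PathCover

/-! ### Degrees of vertices on short paths -/

section PathCoverDegree

variable {V : Type*} {H : SimpleGraph V} [DecidableRel H.Adj]

/-- The number of neighbours of a vertex of a short path on another path. -/
theorem IsMinPathCover.countP_adj_le {B P : List V} {z : V} {R : List (List V)}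
    (h : IsMinPathCover H (B :: P :: R)) (hB : B.length ≤ 2) (hz : z ∈ B) :
    P.countP (H.Adj z) ≤ (if 3 ≤ P.length then 1 else 0) ∨
      ∃ x₁ x₂ x₃ x₄, P = [x₁, x₂, x₃, x₄] ∧ H.Adj z x₂ ∧ H.Adj z x₃ := by
  by_cases h0 : P.countP (H.Adj z) = 0
  · left; omega
  obtain ⟨v, hvP, hv⟩ := List.countP_pos_iff.1 (Nat.pos_of_ne_zero h0)
  have hv : H.Adj z v := by simpa using hv
  obtain ⟨A, C, rfl⟩ := List.append_of_mem hvP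
  obtain ⟨⟨hA, hA2⟩, hC, hC2⟩ := h.length_legs hB hz hv
  have key : ∀ A' C' v', A ++ v :: C = A' ++ v' :: C' → H.Adj z v' →
      (1 ≤ A'.length ∧ A'.length ≤ 2) ∧ 1 ≤ C'.length ∧ C'.length ≤ 2 := by
    intro A' C' v' e hv'
    rw [e] at h
    exact h.length_legs hB hz hv'
  match A, C, hA, hA2, hC, hC2, key with
  | [a], [c], _, _, _, _, key =>
    have h1 : ¬ H.Adj z a := fun hh => by simpa using key [] [v, c] a rfl hh
    have h2 : ¬ H.Adj z c := fun hh => by simpa using key [a, v] [] c rfl hh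
    left; simp [h1, h2, hv]
  | [a], [c, d], _, _, _, _, key =>
    have h1 : ¬ H.Adj z a := fun hh => by simpa using key [] [v, c, d] a rfl hh
    have h2 : ¬ H.Adj z d := fun hh => by simpa using key [a, v, c] [] d rfl hh
    by_cases h3 : H.Adj z c
    · right; exact ⟨a, v, c, d, rfl, hv, h3⟩
    · left; simp [h1, h2, hv, h3]
  | [a, a'], [c], _, _, _, _, key =>
    have h1 : ¬ H.Adj z a := fun hh => by simpa using key [] [a', v, c] a rfl hh
    have h2 : ¬ H.Adj z c := fun hh => by simpa using key [a, a', v] [] c rfl hh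
    by_cases h3 : H.Adj z a'
    · right; exact ⟨a, a', v, c, rfl, h3, hv⟩
    · left; simp [h1, h2, hv, h3]
  | [a, a'], [c, d], _, _, _, _, key =>
    have h1 : ¬ H.Adj z a := fun hh => by simpa using key [] [a', v, c, d] a rfl hh
    have h2 : ¬ H.Adj z a' := fun hh => by simpa using key [a] [v, c, d] a' rfl hh
    have h3 : ¬ H.Adj z c := fun hh => by simpa using key [a, a', v] [d] c rfl hh
    have h4 : ¬ H.Adj z d := fun hh => by simpa using key [a, a', v, c] [] d rfl hh
    left; simp [h1, h2, hv, h3, h4]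

theorem IsMinPathCover.countP_adj_le_of_singleton {b : V} {P : List V} {R : List (List V)}
    (h : IsMinPathCover H ([b] :: P :: R)) :
    P.countP (H.Adj b) ≤ (if 3 ≤ P.length then 1 else 0) := by
  rcases h.countP_adj_le (z := b) (by simp) (by simp) with h1 | ⟨x₁, x₂, x₃, x₄, rfl, h2, h3⟩
  · exact h1
  -- In the exceptional case `b` can be inserted between its two neighbours.
  · refine (h.not_lt (X := [_, _]) (Y := [[x₁, x₂, b, x₃, x₄]]) ?_ ?_ ?_).elim
    · have := h.isChain _ (by simp : [x₁, x₂, x₃, x₄] ∈ _)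
      simp at this
      simp [this, h2.symm, h3]
    · classical
      refine List.perm_iff_count.2 fun a => ?_
      simp [List.count_cons]; ring
    · simp [shortCount]

theorem countP_flatten_le_longCount {q : V → Bool} {R : List (List V)}
    (h : ∀ P ∈ R, P.countP q ≤ (if 3 ≤ P.length then 1 else 0)) :
    R.flatten.countP q ≤ longCount R := by
  induction R with
  | nil => simp
  | cons P R ih =>
    have h1 := h P (by simp)
    have h2 := ih fun P hP => h P (by simp [hP])
    simp only [longCount, List.flatten_cons, List.countP_append, List.countP_cons,
      decide_eq_true_eq] at *
    omega

theorem three_mul_longCount_le (R : List (List V)) : 3 * longCount R ≤ R.flatten.length := by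
  induction R with
  | nil => simp [longCount]
  | cons P R ih =>
    simp only [longCount, List.flatten_cons, List.length_append, List.countP_cons,
      decide_eq_true_eq] at *
    split_ifs <;> omega

variable [Fintype V]

theorem IsPathCover.degree_eq {L : List (List V)} (h : IsPathCover H L) (z : V) :
    H.degree z = L.flatten.countP (H.Adj z) := by
  classical
  rw [List.countP_eq_length_filter, ← List.toFinset_card_of_nodup (h.nodup.filter _),
    ← card_neighborFinset_eq_degree]
  congr 1
  ext v
  have := h.mem v
  simp only [mem_neighborFinset, List.toFinset_filter, Finset.mem_filter, List.mem_toFinset,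
    decide_eq_true_eq]
  exact ⟨fun hv => ⟨this, hv⟩, fun hv => hv.2⟩

theorem IsMinPathCover.degree_le_of_singleton {b : V} {R : List (List V)}
    (h : IsMinPathCover H ([b] :: R)) : 3 * H.degree b + 1 ≤ Fintype.card V := by
  have h1 : R.flatten.countP (H.Adj b) ≤ longCount R := by
    refine countP_flatten_le_longCount fun P hP => ?_
    obtain ⟨R', h', -⟩ := h.exists_perm_cons_cons hP
    exact h'.countP_adj_le_of_singleton
  have h2 := three_mul_longCount_le R
  rw [h.degree_eq, ← h.length_flatten_eq]
  simp only [List.flatten_cons, List.countP_append, List.length_append, List.length_singleton,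
    List.countP_singleton, H.irrefl, decide_false, Bool.false_eq_true, if_false]
  omega

/-- One of the vertices of a path with two vertices has small degree. -/
theorem IsMinPathCover.degree_le_of_pair {z z' : V} {R : List (List V)}
    (h : IsMinPathCover H ([z', z] :: R)) (hz : ¬ 3 * H.degree z ≤ Fintype.card V + 1) :
    3 * H.degree z' ≤ Fintype.card V + 1 ∧
      ∃ x₁ x₂ x₃ x₄, [x₁, x₂, x₃, x₄] ∈ R ∧ H.Adj z x₂ ∧ H.Adj z x₃ := by
  have h1 : ∃ P ∈ R, ¬ P.countP (H.Adj z) ≤ (if 3 ≤ P.length then 1 else 0) := by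
    by_contra! hcon
    have h1 := countP_flatten_le_longCount hcon
    have h2 := three_mul_longCount_le R
    -- With `l` long paths, the partner `z'` gives `deg z ≤ l + 1`, while the pair itself gives `n ≥
    -- 3l + 2`; hence the threshold `n + 1`.
    apply hz
    rw [h.degree_eq, ← h.length_flatten_eq]
    simp only [List.flatten_cons, List.countP_append, List.length_append, List.length_cons,
      List.countP_cons, H.irrefl, decide_false, Bool.false_eq_true, if_false, List.countP_nil,
      List.length_nil]
    split_ifs <;> omega
  obtain ⟨P, hP, hPz⟩ := h1
  obtain ⟨R', h', -⟩ := h.exists_perm_cons_cons hP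
  obtain ⟨x₁, x₂, x₃, x₄, rfl, h2, h3⟩ :=
    (h'.countP_adj_le (z := z) (by simp) (by simp)).resolve_left hPz
  refine ⟨?_, x₁, x₂, x₃, x₄, hP, h2, h3⟩
  -- Moving `z` into the four-vertex path leaves `z'` alone in a minimal cover.
  have h4 : IsMinPathCover H ([[z'], [x₁, x₂, z, x₃, x₄]] ++ R') := by
    refine h'.exchange (X := [_, _]) ?_ ?_ ?_
    · have := h'.isChain _ (by simp : [x₁, x₂, x₃, x₄] ∈ _)
      simp at this
      simp [this, h2.symm, h3]
    · classical
      refine List.perm_iff_count.2 fun a => ?_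
      simp [List.count_cons]; ring
    · simp [shortCount]
  have := h4.degree_le_of_singleton
  omega

end PathCoverDegree

/-! ### Independent vertices of small degree in the legs -/

section Legs

variable {V : Type*} {H : SimpleGraph V}

/-- The outer end of a leg is not adjacent to the other leg of the same centre. -/
theorem IsMinPathCover.not_adj_other_leg {A C : List V} {b v x y : V} {R : List (List V)}
    (h : IsMinPathCover H ([b] :: ((x :: A) ++ v :: C) :: R)) (hv : H.Adj b v) (hy : y ∈ C) :
    ¬ H.Adj x y := by
  intro hxy
  obtain ⟨-, -, hC2⟩ := h.length_legs (by simp) (by simp) hv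
  have hP := h.isChain ((x :: A) ++ v :: C) (by simp)
  have h1 := (List.isChain_split.1 hP).1
  have h2 := (List.isChain_split.1 hP).2
  obtain ⟨Q, hQ, hQp⟩ := exists_perm_isChain_concat h2.tail hC2 hy
  have h3 : (b :: v :: (A.reverse ++ [x])).IsChain H.Adj := by
    have := isChain_adj_reverse h1
    simp only [List.reverse_append, List.reverse_cons, List.reverse_nil, List.nil_append,
      List.singleton_append] at this
    exact List.isChain_cons_cons.2 ⟨hv, this⟩
  have h4 := isChain_join (Q := b :: v :: A.reverse) (Q' := Q.reverse) (by simpa using h3)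
    (by simpa using isChain_adj_reverse hQ) hxy
  refine h.not_lt (X := [_, _]) (Y := [b :: v :: A.reverse ++ x :: y :: Q.reverse]) ?_ ?_ ?_
  · simpa using h4
  · classical
    refine List.perm_iff_count.2 fun a => ?_
    have c := hQp.count_eq a
    simp [List.count_cons] at c ⊢
    rw [← c]
    ring
  · simp [shortCount, List.countP_cons]
    split_ifs <;> omega

variable [DecidableRel H.Adj]

theorem IsMinPathCover.not_adj_of_singleton {A C : List V} {b v u : V} {R : List (List V)}
    (h : IsMinPathCover H ([b] :: (A ++ v :: C) :: R)) (hv : H.Adj b v) (hu : u ∈ A ∨ u ∈ C) :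
    ¬ H.Adj b u := by
  intro hbu
  have h1 := h.countP_adj_le_of_singleton
  simp only [List.countP_append, List.countP_cons, hv, decide_true, if_true] at h1
  have h2 : 0 < A.countP (H.Adj b) + C.countP (H.Adj b) := by
    rcases hu with hu | hu
    · have : 0 < A.countP (H.Adj b) := List.countP_pos_iff.2 ⟨u, hu, by simpa using hbu⟩
      omega
    · have : 0 < C.countP (H.Adj b) := List.countP_pos_iff.2 ⟨u, hu, by simpa using hbu⟩
      omega
  split_ifs at h1 <;> omega

variable [Fintype V]

/-- The outer end is preferred, because `not_adj_other_leg` applies to it; the inner vertex is taken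
only when the outer one has large degree. -/
theorem IsMinPathCover.exists_mem_leg {A C : List V} {b v : V} {R : List (List V)}
    (h : IsMinPathCover H ([b] :: (A ++ v :: C) :: R)) (hv : H.Adj b v) :
    ∃ x ∈ A, 3 * H.degree x ≤ Fintype.card V + 1 ∧ ((∃ A', A = x :: A') ∨
      ∃ x', A = [x', x] ∧ ¬ 3 * H.degree x' ≤ Fintype.card V + 1) := by
  obtain ⟨⟨hA, hA2⟩, -⟩ := h.length_legs (by simp) (by simp) hv
  have he := IsMinPathCover.expose (Z := []) h (by simp) hv
  match A, hA, hA2, he with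
  | [a], _, _, he =>
    have := he.degree_le_of_singleton
    exact ⟨a, by simp, by omega, Or.inl ⟨[], rfl⟩⟩
  | [a, a'], _, _, he =>
    by_cases ha : 3 * H.degree a ≤ Fintype.card V + 1
    · exact ⟨a, by simp, ha, Or.inl ⟨[a'], rfl⟩⟩
    · have hc := he.isChain [a, a'] (by simp)
      have he' := he.perm_head (B' := [a', a]) (isChain_adj_reverse hc) (List.Perm.swap _ _ _)
      exact ⟨a', by simp, (he'.degree_le_of_pair ha).1, Or.inr ⟨a, rfl, ha⟩⟩

/-- Each leg of a centre adjacent to a path with a single vertex contains a vertex of small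
degree, and these vertices can be chosen to be non-adjacent. -/
theorem IsMinPathCover.exists_mem_legs {A C : List V} {b v : V} {R : List (List V)}
    (h : IsMinPathCover H ([b] :: (A ++ v :: C) :: R)) (hv : H.Adj b v) :
    ∃ x ∈ A, ∃ y ∈ C, 3 * H.degree x ≤ Fintype.card V + 1 ∧
      3 * H.degree y ≤ Fintype.card V + 1 ∧ ¬ H.Adj x y := by
  obtain ⟨x, hxA, hx, hx'⟩ := h.exists_mem_leg hv
  obtain ⟨y, hyC, hy, hy'⟩ := h.reverse_centered.exists_mem_leg hv
  refine ⟨x, hxA, y, List.mem_reverse.1 hyC, hx, hy, ?_⟩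
  rcases hx' with ⟨A', rfl⟩ | ⟨x', rfl, hx'⟩
  · exact h.not_adj_other_leg hv (List.mem_reverse.1 hyC)
  rcases hy' with ⟨C', hC'⟩ | ⟨y', hC', -⟩
  · have := h.reverse_centered
    rw [hC'] at this
    exact fun hxy => this.not_adj_other_leg hv (by simp) hxy.symm
  obtain rfl : C = [y, y'] := by simpa using congrArg List.reverse hC'
  intro hxy
  have hP := h.isChain _ (by simp : [x', x] ++ v :: [y, y'] ∈ _)
  simp at hP
  obtain ⟨h1, h2, h3, h4⟩ := hP
  have he := (IsMinPathCover.expose (Z := []) h (by simp) hv).perm_head (B' := [x, x'])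
    (by simpa using h1.symm) (List.Perm.swap _ _ _)
  -- Both chosen vertices are inner here. The large degree of `x'` supplies a four-vertex path able
  -- to absorb it, which frees `x` to be joined to `y`.
  obtain ⟨-, y₁, y₂, y₃, y₄, hY, h5, h6⟩ := he.degree_le_of_pair hx'
  rcases List.mem_cons.1 hY with hY | hY
  · simp at hY
    exact h.not_adj_other_leg hv (y := y₃) (by simp [hY]) h6
  obtain ⟨s, t, rfl⟩ := List.append_of_mem hY
  have h' : IsMinPathCover H ([[b], [x', x, v, y, y'], [y₁, y₂, y₃, y₄]] ++ (s ++ t)) :=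
    h.perm ((List.perm_middle.cons _).cons _)
  refine h'.not_lt (Y := [[y₁, y₂, x', y₃, y₄], [b, v, x, y, y']]) ?_ ?_ ?_
  · have := h'.isChain _ (by simp : [y₁, y₂, y₃, y₄] ∈ _)
    simp at this
    simp [this, h5.symm, h6, hv, h2.symm, hxy, h4]
  · classical
    refine List.perm_iff_count.2 fun a => ?_
    simp [List.count_cons]; ring
  · simp [shortCount]

/-! ### Covers when no minimal cover has a one-vertex path -/

omit [DecidableRel H.Adj] [Fintype V] in
-- Either leg can be exposed as a path of a minimal cover, so `hK` excludes length one. A neighbour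
-- of a short path is therefore the centre of a five-vertex path, which settles the adjacency claims
-- below.
theorem IsMinPathCover.length_legs_eq_two
    (hK : ∀ L, IsMinPathCover H L → ∀ P ∈ L, P.length ≠ 1)
    {B A C : List V} {z v : V} {R : List (List V)}
    (h : IsMinPathCover H (B :: (A ++ v :: C) :: R)) (hB : B.length ≤ 2) (hz : z ∈ B)
    (hzv : H.Adj z v) : A.length = 2 ∧ C.length = 2 := by
  obtain ⟨⟨hA, hA2⟩, hC, hC2⟩ := h.length_legs hB hz hzv
  obtain ⟨Z, hZ, hp⟩ := exists_perm_isChain_concat (h.isChain B (by simp)) hB hz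
  have hl : Z.length ≤ 1 := by
    have := hp.length_eq
    simp at this
    omega
  have h1 := (h.perm_head hZ hp).expose hl hzv
  have h2 := (h.perm_head hZ hp).reverse_centered.expose hl hzv
  have h3 := hK _ h1 A (by simp)
  have h4 := hK _ h2 C.reverse (by simp)
  simp at h4
  omega

omit [DecidableRel H.Adj] [Fintype V] in
theorem IsMinPathCover.not_adj_of_pair
    (hK : ∀ L, IsMinPathCover H L → ∀ P ∈ L, P.length ≠ 1)
    {B A C : List V} {z w v u : V} {R : List (List V)}
    (h : IsMinPathCover H (B :: (A ++ v :: C) :: R)) (hB : B.length ≤ 2) (hz : z ∈ B)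
    (hzv : H.Adj z v) (hw : w ∈ B) (hu : u ∈ A ∨ u ∈ C) : ¬ H.Adj w u := by
  intro hwu
  obtain ⟨hA, hC⟩ := h.length_legs_eq_two hK hB hz hzv
  rcases hu with hu | hu
  · obtain ⟨s, t, rfl⟩ := List.append_of_mem hu
    have := (IsMinPathCover.length_legs_eq_two hK (A := s) (C := t ++ v :: C) (v := u)
      (by simpa using h) hB hw hwu).1
    simp at hA
    omega
  · obtain ⟨s, t, rfl⟩ := List.append_of_mem hu
    have := (IsMinPathCover.length_legs_eq_two hK (A := A ++ v :: s) (C := t) (v := u)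
      (by simpa using h) hB hw hwu).2
    simp at hC
    omega

omit [DecidableRel H.Adj] [Fintype V] in
theorem IsMinPathCover.exists_expose {B A C : List V} {z v : V} {R : List (List V)}
    (h : IsMinPathCover H (B :: (A ++ v :: C) :: R)) (hB : B.length ≤ 2) (hz : z ∈ B)
    (hzv : H.Adj z v) : ∃ Z : List V, IsMinPathCover H (A :: (Z ++ z :: v :: C) :: R) := by
  obtain ⟨Z, hZ, hp⟩ := exists_perm_isChain_concat (h.isChain B (by simp)) hB hz
  refine ⟨Z, (h.perm_head hZ hp).expose ?_ hzv⟩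
  have := hp.length_eq
  simp at this
  omega

omit [DecidableRel H.Adj] [Fintype V] in
theorem IsMinPathCover.not_adj_legs_of_pair_left
    (hK : ∀ L, IsMinPathCover H L → ∀ P ∈ L, P.length ≠ 1)
    {B A C A' C' : List V} {z v v' u u' : V} {R : List (List V)}
    (h : IsMinPathCover H (B :: (A ++ v :: C) :: (A' ++ v' :: C') :: R)) (hB : B.length ≤ 2)
    (hz : z ∈ B) (hzv : H.Adj z v) (hzv' : H.Adj z v') (hu : u ∈ A) (hu' : u' ∈ A') :
    ¬ H.Adj u u' := by
  intro huu'
  obtain ⟨hA, -⟩ := h.length_legs_eq_two hK hB hz hzv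
  obtain ⟨hA', -⟩ := (h.perm ((List.Perm.swap _ _ _).cons _)).length_legs_eq_two hK hB hz hzv'
  obtain ⟨Z, hZ⟩ := h.exists_expose hB hz hzv
  obtain ⟨s, t, rfl⟩ := List.append_of_mem hu'
  -- Once `A` is the short path, its neighbour `u'` would have to be the centre of a path whose
  -- centre is `v'`.
  have := (IsMinPathCover.length_legs_eq_two hK (A := s) (C := t ++ v' :: C') (v := u')
    (by simpa using hZ.perm ((List.Perm.swap _ _ _).cons _)) hA.le hu huu').1
  simp at hA'
  omega

omit [DecidableRel H.Adj] [Fintype V] in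
theorem IsMinPathCover.not_adj_legs_of_pair
    (hK : ∀ L, IsMinPathCover H L → ∀ P ∈ L, P.length ≠ 1)
    {B A C A' C' : List V} {z v v' u u' : V} {R : List (List V)}
    (h : IsMinPathCover H (B :: (A ++ v :: C) :: (A' ++ v' :: C') :: R)) (hB : B.length ≤ 2)
    (hz : z ∈ B) (hv : H.Adj z v) (hv' : H.Adj z v') (hu : u ∈ A ∨ u ∈ C)
    (hu' : u' ∈ A' ∨ u' ∈ C') : ¬ H.Adj u u' := by
  have sw : ∀ {P Q : List V}, IsMinPathCover H (B :: P :: Q :: R) →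
      IsMinPathCover H (B :: Q :: P :: R) := fun h => h.perm ((List.Perm.swap _ _ _).cons _)
  rcases hu with hu | hu <;> rcases hu' with hu' | hu'
  · exact h.not_adj_legs_of_pair_left hK hB hz hv hv' hu hu'
  · exact (sw (sw h).reverse_centered).not_adj_legs_of_pair_left hK hB hz hv hv' hu
      (List.mem_reverse.2 hu')
  · exact h.reverse_centered.not_adj_legs_of_pair_left hK hB hz hv hv' (List.mem_reverse.2 hu) hu'
  · exact (sw (sw h.reverse_centered).reverse_centered).not_adj_legs_of_pair_left hK hB hz hv hv'
      (List.mem_reverse.2 hu) (List.mem_reverse.2 hu')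

theorem IsMinPathCover.exists_degree_le_of_length_two {B : List V} {R : List (List V)}
    (h : IsMinPathCover H (B :: R)) (hB : B.length = 2) :
    ∃ x ∈ B, 3 * H.degree x ≤ Fintype.card V + 1 := by
  match B, hB, h with
  | [a, a'], _, h =>
    by_cases ha : 3 * H.degree a' ≤ Fintype.card V + 1
    · exact ⟨a', by simp, ha⟩
    · exact ⟨a, by simp, (h.degree_le_of_pair ha).1⟩

theorem IsMinPathCover.exists_mem_legs_of_pair
    (hK : ∀ L, IsMinPathCover H L → ∀ P ∈ L, P.length ≠ 1)
    {B A C : List V} {z v : V} {R : List (List V)}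
    (h : IsMinPathCover H (B :: (A ++ v :: C) :: R)) (hB : B.length ≤ 2) (hz : z ∈ B)
    (hzv : H.Adj z v) :
    ∃ x ∈ A, ∃ y ∈ C, 3 * H.degree x ≤ Fintype.card V + 1 ∧
      3 * H.degree y ≤ Fintype.card V + 1 ∧ ¬ H.Adj x y := by
  obtain ⟨hA, hC⟩ := h.length_legs_eq_two hK hB hz hzv
  obtain ⟨Z, hZ⟩ := h.exists_expose hB hz hzv
  obtain ⟨Z', hZ'⟩ := h.reverse_centered.exists_expose hB hz hzv
  obtain ⟨x, hxA, hx⟩ := hZ.exists_degree_le_of_length_two hA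
  obtain ⟨y, hyC, hy⟩ := hZ'.exists_degree_le_of_length_two (by simpa using hC)
  have hyC := List.mem_reverse.1 hyC
  refine ⟨x, hxA, y, hyC, hx, hy, fun hxy => ?_⟩
  obtain ⟨s, t, rfl⟩ := List.append_of_mem hyC
  have := (IsMinPathCover.length_legs_eq_two hK (A := Z ++ z :: v :: s) (C := t) (v := y)
    (by simpa using hZ) hA.le hxA hxy).2
  simp at hC
  omega

omit [DecidableRel H.Adj] [Fintype V] in
/-- From a short path and its adjacent centres one obtains a system of pairwise non-adjacent
vertices, two for each centre and one more. -/
theorem IsMinPathCover.exists_independent_family {G : V → Prop} {B : List V} {z w : V}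
    {R : List (List V)} {N : Finset V} (h : IsMinPathCover H (B :: R)) (hz : z ∈ B) (hw : w ∈ B)
    (hGw : G w) (hN : ∀ v ∈ N, H.Adj z v ∧ v ∉ B)
    (hleg : ∀ v ∈ N, ∀ A C R', IsMinPathCover H (B :: (A ++ v :: C) :: R') →
      ∃ x ∈ A, ∃ y ∈ C, G x ∧ G y ∧ ¬ H.Adj x y)
    (hB : ∀ v ∈ N, ∀ A C R', IsMinPathCover H (B :: (A ++ v :: C) :: R') →
      ∀ w ∈ B, ∀ u, (u ∈ A ∨ u ∈ C) → ¬ H.Adj w u)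
    (hcross : ∀ v ∈ N, ∀ v' ∈ N, ∀ A C A' C' R',
      IsMinPathCover H (B :: (A ++ v :: C) :: (A' ++ v' :: C') :: R') →
      ∀ u u', (u ∈ A ∨ u ∈ C) → (u' ∈ A' ∨ u' ∈ C') → ¬ H.Adj u u') :
    ∃ f : Option (N × Bool) → V, (∀ i, G (f i)) ∧ ∀ i j, i ≠ j → f i ≠ f j ∧ ¬ H.Adj (f i) (f j) := by
  have h1 : ∀ v : N, ∃ A C R' x y, R.Perm ((A ++ v.1 :: C) :: R') ∧ x ∈ A ∧ y ∈ C ∧ G x ∧ G y ∧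
      ¬ H.Adj x y := by
    intro v
    have h2 := h.mem v
    rw [List.flatten_cons, List.mem_append] at h2
    obtain ⟨P, hP, hvP⟩ := List.mem_flatten.1 (h2.resolve_left (hN v v.2).2)
    obtain ⟨A, C, rfl⟩ := List.append_of_mem hvP
    obtain ⟨R', hR', hp⟩ := h.exists_perm_cons_cons hP
    obtain ⟨x, hx, y, hy, hGx, hGy, hxy⟩ := hleg v v.2 A C R' hR'
    exact ⟨A, C, R', x, y, hp, hx, hy, hGx, hGy, hxy⟩
  choose A C R' x y hp hx hy hGx hGy hxy using h1
  have hm : ∀ v : N, IsMinPathCover H (B :: (A v ++ v.1 :: C v) :: R' v) := fun v =>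
    h.perm ((hp v).cons _)
  have hnd : ∀ v : N, x v ≠ y v ∧ ∀ u, (u ∈ A v ∨ u ∈ C v) → w ≠ u := by
    intro v
    have := (hm v).nodup
    simp only [List.flatten_cons, List.nodup_append, List.mem_append, List.mem_cons] at this
    refine ⟨this.2.1.1.2.2 _ (hx v) _ (Or.inr (hy v)), fun u hu => this.2.2 w hw u (Or.inl ?_)⟩
    tauto
  have hcr : ∀ v v' : N, v ≠ v' → ∀ u u', (u ∈ A v ∨ u ∈ C v) → (u' ∈ A v' ∨ u' ∈ C v') →
      u ≠ u' ∧ ¬ H.Adj u u' := by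
    intro v v' hvv' u u' hu hu'
    have h2 : (A v' ++ v'.1 :: C v') ∈ (A v ++ v.1 :: C v) :: R' v :=
      (hp v).mem_iff.1 ((hp v').mem_iff.2 (by simp))
    -- Two neighbours of `z` on one path would put one of them in a leg of the other, against `hB`.
    have h3 : (A v' ++ v'.1 :: C v') ≠ (A v ++ v.1 :: C v) := by
      intro e
      have h4 : v'.1 ∈ A v ++ v.1 :: C v := by rw [← e]; simp
      simp only [List.mem_append, List.mem_cons] at h4
      have h5 := hB v v.2 _ _ _ (hm v) z hz v'.1
      have h6 := (hN v' v'.2).1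
      have h7 : v'.1 ≠ v.1 := fun e => hvv' (Subtype.ext e.symm)
      tauto
    have h4 := (List.mem_cons.1 h2).resolve_left h3
    obtain ⟨s, t, e⟩ := List.append_of_mem h4
    have h5 : IsMinPathCover H
        (B :: (A v ++ v.1 :: C v) :: (A v' ++ v'.1 :: C v') :: (s ++ t)) := by
      have := hm v
      rw [e] at this
      exact this.perm ((List.perm_middle.cons _).cons _)
    refine ⟨?_, hcross v v.2 v' v'.2 _ _ _ _ _ h5 u u' hu hu'⟩
    have := h5.nodup
    simp only [List.flatten_cons, List.nodup_append, List.mem_append, List.mem_cons] at this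
    exact this.2.1.2.2 u (by tauto) u' (by tauto)
  refine ⟨fun i => i.elim w fun p => if p.2 then x p.1 else y p.1, ?_, ?_⟩
  · rintro (_ | ⟨v, _ | _⟩)
    · exact hGw
    · exact hGy v
    · exact hGx v
  · have hleg' : ∀ (v : N) (c : Bool), (if c then x v else y v) ∈ A v ∨
        (if c then x v else y v) ∈ C v := by
      rintro v (_ | _)
      · exact Or.inr (hy v)
      · exact Or.inl (hx v)
    have hw' : ∀ (v : N) (c : Bool), w ≠ (if c then x v else y v) ∧
        ¬ H.Adj w (if c then x v else y v) := fun v c =>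
      ⟨(hnd v).2 _ (hleg' v c), hB v v.2 _ _ _ (hm v) w hw _ (hleg' v c)⟩
    rintro (_ | ⟨v, c⟩) (_ | ⟨v', c'⟩) hij
    · exact (hij rfl).elim
    · exact hw' v' c'
    · exact ⟨(hw' v c).1.symm, fun hh => (hw' v c).2 hh.symm⟩
    · by_cases hvv' : v = v'
      · subst hvv'
        cases c <;> cases c'
        · exact (hij rfl).elim
        · exact ⟨(hnd v).1.symm, fun hh => hxy v hh.symm⟩
        · exact ⟨(hnd v).1, hxy v⟩
        · exact (hij rfl).elim
      · exact hcr v v' hvv' _ _ (hleg' v c) (hleg' v' c')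

end Legs

/-! ### From path covers to path factors -/

section Factor

variable {V : Type*} {H : SimpleGraph V}

theorem IsPathCover.eq_of_mem {L : List (List V)} (h : IsPathCover H L) {P Q : List V}
    (hP : P ∈ L) (hQ : Q ∈ L) {v : V} (hvP : v ∈ P) (hvQ : v ∈ Q) : P = Q := by
  by_contra hne
  have : Std.Symm (List.Disjoint (α := V)) := ⟨fun _ _ h => h.symm⟩
  exact (List.nodup_flatten.1 h.nodup).2.forall hP hQ hne hvP hvQ

/-- The factor keeps only edges between consecutive vertices of a listed path; disjointness of the
lists makes its components exactly these paths. -/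
theorem IsPathCover.exists_isPathFactor {L : List (List V)} {k : ℕ} (h : IsPathCover H L)
    (hk : ∀ P ∈ L, k ≤ P.length) : ∃ F : SimpleGraph V, IsPathFactor H F k := by
  have hnd : ∀ P ∈ L, P.Nodup := (List.nodup_flatten.1 h.nodup).1
  let F : SimpleGraph V :=
    { Adj := fun u v => ∃ P ∈ L, ∃ (i j : ℕ) (hi : i < P.length) (hj : j < P.length),
        (i + 1 = j ∨ j + 1 = i) ∧ P[i] = u ∧ P[j] = v
      symm := ⟨by
        rintro u v ⟨P, hP, i, j, hi, hj, hij, hu, hv⟩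
        exact ⟨P, hP, j, i, hj, hi, hij.symm, hv, hu⟩⟩
      loopless := ⟨by
        rintro u ⟨P, hP, i, j, hi, hj, hij, hu, hv⟩
        have := (hnd P hP).getElem_inj_iff.1 (hu.trans hv.symm)
        omega⟩ }
  have hF : ∀ P ∈ L, ∀ (i j : ℕ) (hi : i < P.length) (hj : j < P.length),
      F.Adj P[i] P[j] ↔ (i + 1 = j ∨ j + 1 = i) := by
    intro P hP i j hi hj
    constructor
    · rintro ⟨Q, hQ, i', j', hi', hj', hij, hu, hv⟩
      obtain rfl := h.eq_of_mem hP hQ (List.getElem_mem hi) (hu ▸ List.getElem_mem hi')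
      have e1 := (hnd P hP).getElem_inj_iff.1 hu
      have e2 := (hnd P hP).getElem_inj_iff.1 hv
      omega
    · exact fun hij => ⟨P, hP, i, j, hi, hj, hij, rfl, rfl⟩
  refine ⟨F, ?_, ?_⟩
  · rintro u v ⟨P, hP, i, j, hi, hj, rfl | rfl, rfl, rfl⟩
    · exact List.isChain_iff_getElem.1 (h.isChain P hP) i hj
    · exact (List.isChain_iff_getElem.1 (h.isChain P hP) j hi).symm
  · intro C
    obtain ⟨v, rfl⟩ := C.exists_rep
    obtain ⟨P, hP, hvP⟩ := List.mem_flatten.1 (h.mem v)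
    obtain ⟨i, hi, rfl⟩ := List.getElem_of_mem hvP
    have hmem : ∀ u w, F.Adj u w → u ∈ P → w ∈ P := by
      rintro u w ⟨Q, hQ, i, j, hi, hj, -, rfl, rfl⟩ hu
      rw [h.eq_of_mem hP hQ hu (List.getElem_mem hi)]
      exact List.getElem_mem hj
    let f : pathGraph P.length ↪g F :=
      { toFun := fun i => P[i]
        inj' := fun i j hij => Fin.ext ((hnd P hP).getElem_inj_iff.1 hij)
        map_rel_iff' := by
          intro a b
          rw [pathGraph_adj]
          exact hF P hP a b a.2 b.2 }
    have hreach : ∀ w, F.Reachable P[i] w ↔ ∃ j, f j = w := by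
      intro w
      constructor
      · intro hw
        have : w ∈ P := by
          obtain ⟨p⟩ := hw
          have key : ∀ {a b : V}, F.Walk a b → a ∈ P → b ∈ P := by
            intro a b p
            induction p with
            | nil => exact id
            | cons hadj _ ih => exact fun ha => ih (hmem _ _ hadj ha)
          exact key p hvP
        obtain ⟨j, hj, rfl⟩ := List.getElem_of_mem this
        exact ⟨⟨j, hj⟩, rfl⟩
      · rintro ⟨j, rfl⟩
        exact (pathGraph_preconnected _ ⟨i, hi⟩ j).map f.toHom
    refine ⟨P.length, hk P hP, ⟨RelIso.symm ⟨Equiv.ofBijective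
      (fun j => ⟨f j, ?_⟩) ⟨fun a b hab => f.injective (congrArg Subtype.val hab), ?_⟩, ?_⟩⟩⟩
    · exact ConnectedComponent.sound ((hreach _).2 ⟨j, rfl⟩).symm
    · rintro ⟨w, hw⟩
      obtain ⟨j, hj⟩ := (hreach w).1 (ConnectedComponent.exact hw).symm
      exact ⟨j, Subtype.ext hj⟩
    · intro a b
      exact f.map_rel_iff

theorem exists_isMinPathCover [Fintype V] (H : SimpleGraph V) : ∃ L, IsMinPathCover H L := by
  classical
  have h0 : ∃ L, IsPathCover H L := by
    refine ⟨(Finset.univ : Finset V).toList.map fun v => [v], ?_, ?_, ?_, ?_⟩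
    · simp
    · simp
    · rw [← List.flatMap_def, List.flatMap_singleton']
      exact Finset.nodup_toList _
    · intro v
      rw [← List.flatMap_def, List.flatMap_singleton']
      simp
  have h1 : ∃ n, ∃ L, IsPathCover H L ∧ shortCount L = n := by
    obtain ⟨L, hL⟩ := h0
    exact ⟨_, L, hL, rfl⟩
  obtain ⟨L, hL, hn⟩ := Nat.find_spec h1
  exact ⟨L, hL, fun L' hL' => hn.le.trans (Nat.find_min' h1 ⟨L', hL', rfl⟩)⟩

theorem exists_length_le_two_of_not_isPathFactor {L : List (List V)} (h : IsPathCover H L)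
    (hF : ¬ ∃ F : SimpleGraph V, IsPathFactor H F 3) : ∃ P ∈ L, P.length ≤ 2 := by
  by_contra! hcon
  exact hF (h.exists_isPathFactor hcon)

/-- A graph without a `P_{≥ 3}`-factor contains a path `B` with one or two vertices such that, for
each vertex `z` of `B`, there is an independent family of vertices of small degree with two members
for each neighbour of `z` outside `B`, and one more. -/
theorem exists_independent_family_of_not_isPathFactor [Fintype V] [DecidableEq V]
    [DecidableRel H.Adj] (hF : ¬ ∃ F : SimpleGraph V, IsPathFactor H F 3) :
    ∃ B : List V, (B.length = 1 ∨ B.length = 2) ∧ B.IsChain H.Adj ∧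
      ∀ z ∈ B, ∃ f : Option ({v // v ∈ (H.neighborFinset z) \ B.toFinset} × Bool) → V,
      (∀ i, 3 * H.degree (f i) ≤ Fintype.card V + 1) ∧
        ∀ i j, i ≠ j → f i ≠ f j ∧ ¬ H.Adj (f i) (f j) := by
  have hN : ∀ (B : List V) (z : V), ∀ v ∈ (H.neighborFinset z) \ B.toFinset,
      H.Adj z v ∧ v ∉ B := by
    intro B z v hv
    simpa using hv
  -- A one-vertex path of any minimal cover is used if there is one; otherwise the rigid five-vertex
  -- structure is available.
  by_cases hK : ∀ L, IsMinPathCover H L → ∀ P ∈ L, P.length ≠ 1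
  · obtain ⟨L, hL⟩ := exists_isMinPathCover H
    obtain ⟨B, hBL, hB⟩ := exists_length_le_two_of_not_isPathFactor hL.toIsPathCover hF
    obtain ⟨R, h, -⟩ := hL.exists_perm_cons hBL
    have h1 := hK L hL B hBL
    have h0 := List.length_pos_iff.2 (hL.ne_nil B hBL)
    have h2 : B.length = 2 := by omega
    refine ⟨B, Or.inr h2, h.isChain B (by simp), fun z hz => ?_⟩
    obtain ⟨w, hw, hGw⟩ := h.exists_degree_le_of_length_two h2
    refine h.exists_independent_family (G := fun x => 3 * H.degree x ≤ Fintype.card V + 1)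
      hz hw hGw (hN B z) ?_ ?_ ?_
    · intro v hv A C R' h'
      exact h'.exists_mem_legs_of_pair hK hB hz (hN B z v hv).1
    · intro v hv A C R' h' w hw u hu
      exact h'.not_adj_of_pair hK hB hz (hN B z v hv).1 hw hu
    · intro v hv v' hv' A C A' C' R' h' u u' hu hu'
      exact h'.not_adj_legs_of_pair hK hB hz (hN B z v hv).1 (hN B z v' hv').1 hu hu'
  · push Not at hK
    obtain ⟨L, hL, B, hBL, hB⟩ := hK
    obtain ⟨b, rfl⟩ := List.length_eq_one_iff.1 hB
    obtain ⟨R, h, -⟩ := hL.exists_perm_cons hBL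
    refine ⟨[b], Or.inl rfl, by simp, fun z hz => ?_⟩
    obtain rfl : z = b := by simpa using hz
    refine h.exists_independent_family (G := fun x => 3 * H.degree x ≤ Fintype.card V + 1)
      hz hz ?_ (hN [z] z) ?_ ?_ ?_
    · have := h.degree_le_of_singleton
      omega
    · intro v hv A C R' h'
      exact h'.exists_mem_legs (hN [z] z v hv).1
    · intro v hv A C R' h' w hw u hu
      obtain rfl : w = z := by simpa using hw
      exact h'.not_adj_of_singleton (hN [w] w v hv).1 hu
    · intro v hv v' hv' A C A' C' R' h' u u' hu hu'
      exact h'.not_adj_legs (hN [z] z v hv).1 (hN [z] z v' hv').1 hu hu'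

end Factor

/-! ### Connectivity and the effect of deleting edges -/

section DeletedEdges

variable {V : Type*} [Fintype V] (G : SimpleGraph V) [DecidableRel G.Adj]

/-- Deleting all neighbours of `v` isolates it or leaves it alone. -/
theorem vertexConnectivity_le_degree (v : V) : G.vertexConnectivity ≤ G.degree v := by
  classical
  refine Nat.sInf_le ⟨G.neighborFinset v, rfl, ?_⟩
  by_contra! hcon
  obtain ⟨hpre, hcard⟩ := hcon
  have hv : v ∉ G.neighborFinset v := by simp
  have h1 : (insert v (G.neighborFinset v)).card < Fintype.card V := by
    rwa [Finset.card_insert_of_notMem hv]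
  obtain ⟨w, hw⟩ : ∃ w, w ∉ insert v (G.neighborFinset v) := by
    by_contra! hall
    rw [Finset.eq_univ_iff_forall.2 hall, Finset.card_univ] at h1
    exact lt_irrefl _ h1
  simp only [Finset.mem_insert, not_or] at hw
  have hne : (⟨v, by simp⟩ : ((G.neighborFinset v : Set V)ᶜ : Set V)) ≠
      ⟨w, by simpa using hw.2⟩ := fun e => hw.1 (congrArg Subtype.val e).symm
  obtain ⟨p⟩ := hpre ⟨v, by simp⟩ ⟨w, by simpa using hw.2⟩
  cases p with
  | nil => exact hne rfl
  | @cons _ x _ hadj _ =>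
    have := x.2
    simp at this
    exact this hadj

variable [DecidableEq V] (E : Finset (Sym2 V)) [DecidableRel (G.deleteEdges (E : Set (Sym2 V))).Adj]

theorem degree_le_degree_deleteEdges_add (v : V) :
    G.degree v ≤ (G.deleteEdges (E : Set (Sym2 V))).degree v + (E.filter (v ∈ ·)).card := by
  rw [← card_neighborFinset_eq_degree, ← card_neighborFinset_eq_degree]
  have h1 : G.neighborFinset v ⊆ (G.deleteEdges (E : Set (Sym2 V))).neighborFinset v ∪
      (G.neighborFinset v).filter (fun w => s(v, w) ∈ E) := by
    intro w hw
    simp at hw ⊢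
    tauto
  have h2 : ((G.neighborFinset v).filter (fun w => s(v, w) ∈ E)).card ≤
      (E.filter (v ∈ ·)).card := by
    refine Finset.card_le_card_of_injOn (fun w => s(v, w)) ?_ ?_
    · intro w hw
      simp at hw ⊢
      exact hw.2
    · intro a _ b _ hab
      exact Sym2.congr_right.1 hab
  exact (Finset.card_le_card h1).trans ((Finset.card_union_le _ _).trans (by omega))

omit [DecidableEq V] in
theorem degree_deleteEdges_eq {v : V} (hv : ∀ e ∈ E, v ∉ e) :
    G.degree v = (G.deleteEdges (E : Set (Sym2 V))).degree v := by
  rw [← card_neighborFinset_eq_degree, ← card_neighborFinset_eq_degree]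
  congr 1
  ext w
  simp only [mem_neighborFinset, deleteEdges_adj, Finset.mem_coe]
  exact ⟨fun h => ⟨h, fun he => hv _ he (by simp)⟩, fun h => h.1⟩

omit [Fintype V] [DecidableRel G.Adj] [DecidableRel (G.deleteEdges (E : Set (Sym2 V))).Adj] in
/-- A large independent family of `G - E` contains three vertices that meet no edge of `E`, and
these are independent in `G`. -/
theorem exists_isNIndepSet_of_family {ι : Type*} [Fintype ι] (f : ι → V)
    (hf : ∀ i j, i ≠ j → f i ≠ f j ∧ ¬ (G.deleteEdges (E : Set (Sym2 V))).Adj (f i) (f j))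
    (hcard : 2 * E.card + 3 ≤ Fintype.card ι) :
    ∃ X : Finset V, G.IsNIndepSet 3 X ∧ ∀ x ∈ X, (∃ i, f i = x) ∧ ∀ e ∈ E, x ∉ e := by
  have hinj : Function.Injective f := fun i j hij => by
    by_contra hne
    exact (hf i j hne).1 hij
  have hT : (E.biUnion Sym2.toFinset).card ≤ 2 * E.card := by
    rw [mul_comm]
    refine Finset.card_biUnion_le_card_mul _ _ _ fun e _ => ?_
    by_cases he : e.IsDiag
    · rw [Sym2.card_toFinset_of_isDiag e he]; omega
    · rw [Sym2.card_toFinset_of_not_isDiag e he]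
  have h1 : 3 ≤ ((Finset.univ.image f) \ E.biUnion Sym2.toFinset).card := by
    have := Finset.le_card_sdiff (E.biUnion Sym2.toFinset) (Finset.univ.image f)
    rw [Finset.card_image_of_injective _ hinj, Finset.card_univ] at this
    omega
  obtain ⟨X, hX, hX3⟩ := Finset.exists_subset_card_eq h1
  have hX' : ∀ x ∈ X, (∃ i, f i = x) ∧ ∀ e ∈ E, x ∉ e := by
    intro x hx
    have := hX hx
    simpa using this
  refine ⟨X, ⟨?_, hX3⟩, hX'⟩
  intro x hx y hy hxy hadj
  obtain ⟨⟨i, rfl⟩, hi⟩ := hX' x hx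
  obtain ⟨⟨j, rfl⟩, -⟩ := hX' y hy
  refine (hf i j fun hij => hxy (by rw [hij])).2 ?_
  rw [deleteEdges_adj]
  exact ⟨hadj, fun he => hi _ he (by simp)⟩

/-- If the minimum degree of `G` is more than twice the number of edges of `E`, then in `G - E` a
path with one or two vertices has a vertex with many neighbours outside the path. -/
theorem exists_card_neighborFinset_sdiff {B : List V} (hB : B.length = 1 ∨ B.length = 2)
    (hc : B.IsChain (G.deleteEdges (E : Set (Sym2 V))).Adj)
    (hδ : ∀ v, 2 * E.card + 1 ≤ G.degree v) (hE : 1 ≤ E.card) :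
    ∃ z ∈ B, E.card + 1 ≤
      ((G.deleteEdges (E : Set (Sym2 V))).neighborFinset z \ B.toFinset).card := by
  rcases hB with hB | hB
  · obtain ⟨b, rfl⟩ := List.length_eq_one_iff.1 hB
    refine ⟨b, by simp, ?_⟩
    have h1 := G.degree_le_degree_deleteEdges_add E b
    have h2 := hδ b
    have h3 := Finset.card_filter_le E (b ∈ ·)
    rw [Finset.sdiff_eq_self_of_disjoint (by simp), card_neighborFinset_eq_degree]
    omega
  · obtain ⟨a, b, rfl⟩ := List.length_eq_two.1 hB
    have hab : (G.deleteEdges (E : Set (Sym2 V))).Adj a b := by simpa using hc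
    -- A common edge could only be `ab`, which survives the deletion.
    have hdisj : Disjoint (E.filter (a ∈ ·)) (E.filter (b ∈ ·)) := by
      rw [Finset.disjoint_left]
      intro e h1 h2
      simp only [Finset.mem_filter] at h1 h2
      obtain rfl := (Sym2.mem_and_mem_iff hab.ne).1 ⟨h1.2, h2.2⟩
      rw [deleteEdges_adj] at hab
      exact hab.2 h1.1
    have hsum : (E.filter (a ∈ ·)).card + (E.filter (b ∈ ·)).card ≤ E.card := by
      rw [← Finset.card_union_of_disjoint hdisj]
      exact Finset.card_le_card (Finset.union_subset (Finset.filter_subset _ _)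
        (Finset.filter_subset _ _))
    have hs : ∀ z z' : V, ([a, b].toFinset : Finset V) = {z, z'} →
        (G.deleteEdges (E : Set (Sym2 V))).degree z ≤
          ((G.deleteEdges (E : Set (Sym2 V))).neighborFinset z \ [a, b].toFinset).card + 1 := by
      intro z z' e
      rw [e, ← card_neighborFinset_eq_degree]
      have h1 : (G.deleteEdges (E : Set (Sym2 V))).neighborFinset z ⊆
          insert z' ((G.deleteEdges (E : Set (Sym2 V))).neighborFinset z \ {z, z'}) := by
        intro w hw
        have : w ≠ z := fun e => by simp [e] at hw
        simp only [Finset.mem_insert, Finset.mem_sdiff, Finset.mem_singleton]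
        tauto
      exact (Finset.card_le_card h1).trans (Finset.card_insert_le _ _)
    have h1 := hs a b (by simp)
    have h2 := hs b a (by simp [Finset.pair_comm])
    have h3 := G.degree_le_degree_deleteEdges_add E a
    have h4 := G.degree_le_degree_deleteEdges_add E b
    have h5 := hδ a
    have h6 := hδ b
    -- If `a` meets all of `E`, then `b` meets none. An end losing fewer than `E.card` edges
    -- compensates for its partner, which is not counted.
    by_cases h7 : (E.filter (a ∈ ·)).card < E.card
    · exact ⟨a, by simp, by omega⟩
    · exact ⟨b, by simp, by omega⟩

end DeletedEdges

end SimpleGraph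

/-! ### The degree sum contradiction -/

theorem theorem5 {V : Type*} [Fintype V] (G : SimpleGraph V) [DecidableRel G.Adj] (m : ℕ)
    (hm : 1 ≤ m) (hκ : 2 * m + 1 ≤ G.vertexConnectivity)
    (hσ : ((Fintype.card V + 2 * m : ℕ) : ℕ∞) ≤ G.degreeSum 3) :
    G.IsPathFactorDeleted 3 m := by
  classical
  intro E _ hEm
  by_contra hF
  obtain ⟨B, hB, hc, hfam⟩ := SimpleGraph.exists_independent_family_of_not_isPathFactor hF
  obtain ⟨z, hz, hN⟩ := G.exists_card_neighborFinset_sdiff E hB hc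
    (fun v => by have := G.vertexConnectivity_le_degree v; omega) (by omega)
  obtain ⟨f, hdeg, hf⟩ := hfam z hz
  obtain ⟨X, hX, hXf⟩ := G.exists_isNIndepSet_of_family E f hf (by
    rw [Fintype.card_option, Fintype.card_prod, Fintype.card_coe, Fintype.card_bool]
    omega)
  have h1 : ((Fintype.card V + 2 * m : ℕ) : ℕ∞) ≤ ((∑ x ∈ X, G.degree x : ℕ) : ℕ∞) :=
    hσ.trans (iInf₂_le X hX)
  have h2 : Fintype.card V + 2 * m ≤ ∑ x ∈ X, G.degree x := by exact_mod_cast h1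
  have h3 : ∑ x ∈ X, 3 * G.degree x ≤ X.card • (Fintype.card V + 1) := by
    refine Finset.sum_le_card_nsmul _ _ _ fun x hx => ?_
    obtain ⟨⟨i, rfl⟩, hi⟩ := hXf x hx
    rw [G.degree_deleteEdges_eq E hi]
    exact hdeg i
  rw [← Finset.mul_sum, hX.card_eq, smul_eq_mul] at h3
  -- Three times the degree sum is at most `3(n + 1)`, and `n + 1 < n + 2m` since `m ≥ 1`.
  omega
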